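/- Let $S_1$ and $S_2$ be two isometries on a complex Hilbert space $\mathcal H$ satisfying the Cuntz relation $S_1S_1^*+S_2S_2^*=1$. For bounded operators $X_1,\dots,X_k$ on $\mathcal H$, let $C^*(X_1,\dots,X_k)$ denote the unital C*-subalgebra of $B(\mathcal H)$ that they generate. Call $u\in B(\mathcal H)$ an order-two intertwiner if $u$ is unitary, $u^2=1$ and $uS_1=S_2u$. Then: 1. If $u$ and $w$ are order-two intertwiners with $C^*(S_1,S_2,u)\subseteq C^*(S_1,S_2,w)$, then $u=w$ or $u=-w$. 2. Consequently, if $\mathcal H\neq 0$ and $w$ is an order-two intertwiner, then the set of order-two intertwiners $u$ with $C^*(S_1,S_2,u)\subseteq C^*(S_1,S_2,w)$ is exactly the pair $\{w,-w\}$, with $w\ne -w$. 3. If $C^*(S_1,S_2)$ acts irreducibly on $\mathcal H$ (that is, $\mathcal H\neq0$ and the only closed subspaces invariant under $C^*(S_1,S_2)$ are $0$ and $\mathcal H$), then the set of all order-two intertwiners is either empty or a pair $\{w,-w\}$ with $w\neq -w$. -/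

import Mathlib

/-- `S₁` and `S₂` are isometries of `H` satisfying the Cuntz relation
`S₁ S₁⋆ + S₂ S₂⋆ = 1`; equivalently, they are the images of the canonical generators under a
unital representation of the Cuntz algebra `𝒪₂` on `H`. -/
structure IsCuntzPair {H : Type*} [NormedAddCommGroup H] [InnerProductSpace ℂ H]
    [CompleteSpace H] (S₁ S₂ : H →L[ℂ] H) : Prop where
  isometry_left : Isometry S₁
  isometry_right : Isometry S₂
  cuntz_relation : S₁ * star S₁ + S₂ * star S₂ = 1

/-- `u` is a unitary with `u ^ 2 = 1` and `u S₁ = S₂ u`. -/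
structure IsOrderTwoIntertwiner {H : Type*} [NormedAddCommGroup H] [InnerProductSpace ℂ H]
    [CompleteSpace H] (S₁ S₂ u : H →L[ℂ] H) : Prop where
  mem_unitary : u ∈ unitary (H →L[ℂ] H)
  sq_eq_one : u ^ 2 = 1
  intertwines : u * S₁ = S₂ * u

/-- `C⋆(X)`: the norm-closed unital star subalgebra of `B(H)` generated by `X`. When `X` contains
an isometry `S`, it contains `1 = S⋆ S` anyway, so it is the C⋆-algebra generated by `X`. -/
noncomputable def cstarGenerated {H : Type*} [NormedAddCommGroup H] [InnerProductSpace ℂ H]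
    [CompleteSpace H] (X : Set (H →L[ℂ] H)) : StarSubalgebra ℂ (H →L[ℂ] H) :=
  (StarAlgebra.adjoin ℂ X).topologicalClosure

/-- `B` acts irreducibly on `H`: `H ≠ 0` and the only closed subspaces invariant under `B` are
`0` and `H`. -/
def ActsIrreducibly {H : Type*} [NormedAddCommGroup H] [InnerProductSpace ℂ H]
    [CompleteSpace H] (B : StarSubalgebra ℂ (H →L[ℂ] H)) : Prop :=
  Nontrivial H ∧ ∀ K : Submodule ℂ H, IsClosed (K : Set H) →
    (∀ a ∈ B, ∀ x ∈ K, a x ∈ K) → K = ⊥ ∨ K = ⊤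

/-! Two order-two intertwiners `u`, `w` both swap `S₁` and `S₂`, so `z = u w` commutes with both.
Once `z` is a scalar `c`, `u = c w` and `u² = w² = 1` force `c = ±1`.

If `u` lies in `C⋆(S₁, S₂, w)`, so does `z`. Write `a = S₁`, `b = S₂` and compress by the isometries
`tₙ = aⁿ b`. Monomials `p q⋆` and `p q⋆ w` in words `p`, `q` span a dense subalgebra, and on each of
them `tₙ⋆ x tₙ` is eventually `0` or `1` (`IsWordMonomial.eventually_compression`). Compression is
contractive and fixes `z`, so `z` is a limit of scalars
(`exists_eq_algebraMap_of_commute_of_mem_closure`).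

In the irreducible case `z` is a normal operator commuting with `C⋆(S₁, S₂)`, and Schur's lemma
applies. -/

theorem exists_word_of_intertwines {M : Type*} [Monoid M] {a b w : M} (hwa : w * a = b * w) (hwb : w * b = a * w) {p : M}
    (hp : p ∈ Submonoid.closure {a, b}) : ∃ p' ∈ Submonoid.closure {a, b}, w * p = p' * w := by
  have ma : a ∈ Submonoid.closure {a, b} := Submonoid.subset_closure (by simp)
  have mb : b ∈ Submonoid.closure {a, b} := Submonoid.subset_closure (by simp)
  induction hp using Submonoid.closure_induction with
  | mem x hx =>
    rcases hx with rfl | rfl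
    · exact ⟨b, mb, hwa⟩
    · exact ⟨a, ma, hwb⟩
  | one => exact ⟨1, one_mem _, by simp⟩
  | mul x y _ _ hx hy =>
    obtain ⟨x', hx', ex⟩ := hx
    obtain ⟨y', hy', ey⟩ := hy
    exact ⟨x' * y', mul_mem hx' hy', by rw [← mul_assoc, ex, mul_assoc, ey, mul_assoc]⟩

/-! ### Word monomials and their compressions -/

section StarRing

variable {A : Type*} [Ring A] [StarRing A] {a b w : A}

/-- Words in the orthogonal isometries `a`, `b`: stripping one letter from the left of a word by
the adjoint of a letter gives a word, zero, or the adjoint letter itself. -/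
theorem star_mul_word (ha : star a * a = 1) (hab : star a * b = 0) {p : A}
    (hp : p ∈ Submonoid.closure {a, b}) :
    p = 1 ∨ star a * p = 0 ∨ star a * p ∈ Submonoid.closure {a, b} := by
  induction hp using Submonoid.closure_induction_left with
  | one => exact Or.inl rfl
  | mul_left x hx y hy _ =>
    rcases hx with rfl | rfl
    · exact Or.inr (Or.inr (by rwa [← mul_assoc, ha, one_mul]))
    · exact Or.inr (Or.inl (by rw [← mul_assoc, hab, zero_mul]))

/-- A word monomial is `p q⋆`, `p q⋆ w` or `0` for words `p`, `q` in `a` and `b`. -/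
def IsWordMonomial (a b w x : A) : Prop :=
  x = 0 ∨ ∃ p ∈ Submonoid.closure {a, b}, ∃ q ∈ Submonoid.closure {a, b},
    x = p * star q ∨ x = p * star q * w

theorem IsWordMonomial.mul_left_letter {x : A} (hx : IsWordMonomial a b w x) {g : A}
    (hg : g ∈ Submonoid.closure {a, b}) : IsWordMonomial a b w (g * x) := by
  rcases hx with rfl | ⟨p, hp, q, hq, rfl | rfl⟩
  · exact Or.inl (mul_zero g)
  · exact Or.inr ⟨g * p, mul_mem hg hp, q, hq, Or.inl (by simp only [mul_assoc])⟩
  · exact Or.inr ⟨g * p, mul_mem hg hp, q, hq, Or.inr (by simp only [mul_assoc])⟩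

theorem IsWordMonomial.star_mul_left {x : A} (hx : IsWordMonomial a b w x) {g : A}
    (hg : g ∈ Submonoid.closure {a, b})
    (h : ∀ p ∈ Submonoid.closure {a, b},
      p = 1 ∨ star g * p = 0 ∨ star g * p ∈ Submonoid.closure {a, b}) :
    IsWordMonomial a b w (star g * x) := by
  rcases hx with rfl | ⟨p, hp, q, hq, hx⟩
  · exact Or.inl (mul_zero _)
  rcases h p hp with rfl | h0 | hm
  · refine Or.inr ⟨1, one_mem _, q * g, mul_mem hq hg, ?_⟩
    rcases hx with rfl | rfl
    · exact Or.inl (by simp)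
    · exact Or.inr (by simp [mul_assoc])
  · left
    rcases hx with rfl | rfl <;> simp only [← mul_assoc, h0, zero_mul]
  · refine Or.inr ⟨_, hm, q, hq, ?_⟩
    rcases hx with rfl | rfl
    · exact Or.inl (by simp only [mul_assoc])
    · exact Or.inr (by simp only [mul_assoc])

theorem IsWordMonomial.intertwiner_mul_left (hw : star w = w) (hw2 : w * w = 1)
    (hwa : w * a = b * w) (hwb : w * b = a * w) {x : A} (hx : IsWordMonomial a b w x) :
    IsWordMonomial a b w (w * x) := by
  rcases hx with rfl | ⟨p, hp, q, hq, hx⟩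
  · exact Or.inl (mul_zero _)
  obtain ⟨p', hp', ep⟩ := exists_word_of_intertwines hwa hwb hp
  obtain ⟨q', hq', eq⟩ := exists_word_of_intertwines hwa hwb hq
  have eq' : w * star q = star q' * w := by
    have : q * w = w * q' := by
      calc q * w = w * (w * q) * w := by rw [← mul_assoc, hw2, one_mul]
        _ = w * q' := by rw [eq, mul_assoc, mul_assoc, hw2, mul_one]
    simpa [hw] using congrArg star this
  have e : w * (p * star q) = p' * star q' * w := by
    rw [← mul_assoc, ep, mul_assoc, eq', mul_assoc]
  refine Or.inr ⟨p', hp', q', hq', ?_⟩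
  rcases hx with rfl | rfl
  · exact Or.inr e
  · left
    rw [← mul_assoc, e, mul_assoc, hw2, mul_one]

theorem isWordMonomial_of_mem_closure (ha : star a * a = 1) (hb : star b * b = 1)
    (hab : star a * b = 0) (hw : star w = w) (hw2 : w * w = 1)
    (hwa : w * a = b * w) (hwb : w * b = a * w) {x : A}
    (hx : x ∈ Submonoid.closure ({a, b, w} ∪ star {a, b, w} : Set A)) :
    IsWordMonomial a b w x := by
  have ma : a ∈ Submonoid.closure {a, b} := Submonoid.subset_closure (by simp)
  have mb : b ∈ Submonoid.closure {a, b} := Submonoid.subset_closure (by simp)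
  have hba : star b * a = 0 := by simpa using congrArg star hab
  induction hx using Submonoid.closure_induction_left with
  | one => exact Or.inr ⟨1, one_mem _, 1, one_mem _, Or.inl (by simp)⟩
  | mul_left g hg y _ hy =>
    have hA := hy.star_mul_left ma fun p hp => star_mul_word ha hab hp
    have hB := hy.star_mul_left mb fun p hp => by
      rw [Set.pair_comm] at hp ⊢
      exact star_mul_word hb hba hp
    have hW := hy.intertwiner_mul_left hw hw2 hwa hwb
    rcases hg with (rfl | rfl | rfl) | hg
    · exact hy.mul_left_letter ma
    · exact hy.mul_left_letter mb
    · exact hW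
    · rcases hg with hg | hg | hg
      · rwa [← star_star g, show star g = _ from hg]
      · rwa [← star_star g, show star g = _ from hg]
      · rwa [← star_star g, show star g = _ from hg, hw]

/-- Take `k` to be the length of `p`. The final `b` is then never reached: each letter `a` of `p`
cancels one `a`, and any letter `b` gives zero. -/
theorem star_word_mul_pow_mul (ha : star a * a = 1) (hba : star b * a = 0) {p : A}
    (hp : p ∈ Submonoid.closure {a, b}) :
    ∃ k : ℕ, (∀ n, star p * (a ^ (n + k) * b) = 0) ∨
      ∀ n, star p * (a ^ (n + k) * b) = a ^ n * b := by
  induction hp using Submonoid.closure_induction with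
  | mem x hx =>
    refine ⟨1, ?_⟩
    rcases hx with rfl | rfl
    · exact Or.inr fun n => by rw [pow_succ', mul_assoc, ← mul_assoc, ha, one_mul]
    · exact Or.inl fun n => by rw [pow_succ', mul_assoc, ← mul_assoc, hba, zero_mul]
  | one => exact ⟨0, Or.inr fun n => by simp⟩
  | mul x y _ _ hx hy =>
    obtain ⟨k, hk⟩ := hx
    obtain ⟨l, hl⟩ := hy
    refine ⟨l + k, ?_⟩
    simp only [star_mul, mul_assoc, ← add_assoc]
    rcases hk with hk | hk
    · exact Or.inl fun n => by rw [hk, mul_zero]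
    · simpa only [hk] using hl

theorem star_pow_mul_mul_pow_mul (ha : star a * a = 1) (hb : star b * b = 1)
    (hab : star a * b = 0) (m n : ℕ) :
    star (a ^ m * b) * (a ^ n * b) = if m = n then 1 else 0 := by
  have hba : star b * a = 0 := by simpa using congrArg star hab
  induction m generalizing n with
  | zero =>
    cases n with
    | zero => simp [hb]
    | succ n => simp [pow_succ', ← mul_assoc, hba]
  | succ m ih =>
    cases n with
    | zero => simp [pow_succ', mul_assoc, hab]
    | succ n =>
      have := ih n
      simp only [Nat.add_right_cancel_iff]
      rw [← this]
      simp only [pow_succ' a, star_mul, mul_assoc]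
      rw [← mul_assoc (star a) a, ha, one_mul]

/-- Compression of a word monomial by `aⁿ b` is eventually `0` or `1`. -/
theorem IsWordMonomial.eventually_compression (ha : star a * a = 1) (hb : star b * b = 1)
    (hab : star a * b = 0) (hwa : w * a = b * w) (hwb : w * b = a * w) {x : A}
    (hx : IsWordMonomial a b w x) :
    (∀ᶠ n in Filter.atTop, star (a ^ n * b) * x * (a ^ n * b) = 0) ∨
      ∀ᶠ n in Filter.atTop, star (a ^ n * b) * x * (a ^ n * b) = 1 := by
  have hba : star b * a = 0 := by simpa using congrArg star hab
  rcases hx with rfl | ⟨p, hp, q, hq, hx⟩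
  · simp
  obtain ⟨k, hk⟩ := star_word_mul_pow_mul ha hba hp
  rcases hx with rfl | rfl
  · obtain ⟨l, hl⟩ := star_word_mul_pow_mul ha hba hq
    have e (n : ℕ) : star (a ^ n * b) * (p * star q) * (a ^ n * b) =
        star (star p * (a ^ n * b)) * (star q * (a ^ n * b)) := by
      simp [mul_assoc]
    simp only [e]
    rcases hk with hk | hk
    · refine Or.inl (Filter.eventually_atTop.2 ⟨k, fun n hn => ?_⟩)
      obtain ⟨m, rfl⟩ := Nat.exists_eq_add_of_le' hn
      rw [hk, star_zero, zero_mul]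
    rcases hl with hl | hl
    · refine Or.inl (Filter.eventually_atTop.2 ⟨l, fun n hn => ?_⟩)
      obtain ⟨m, rfl⟩ := Nat.exists_eq_add_of_le' hn
      rw [hl, mul_zero]
    -- The two factors reduce to `a ^ (m + l) * b` and `a ^ (m + k) * b`, which are orthogonal
    -- unless `k = l`.
    have key (m : ℕ) : star (star p * (a ^ (m + (k + l)) * b)) *
        (star q * (a ^ (m + (k + l)) * b)) = if l = k then 1 else 0 := by
      have h1 := hk (m + l)
      have h2 := hl (m + k)
      rw [show m + l + k = m + (k + l) by ring] at h1
      rw [show m + k + l = m + (k + l) by ring] at h2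
      rw [h1, h2, star_pow_mul_mul_pow_mul ha hb hab]
      simp
    by_cases hkl : l = k
    · refine Or.inr (Filter.eventually_atTop.2 ⟨k + l, fun n hn => ?_⟩)
      obtain ⟨m, rfl⟩ := Nat.exists_eq_add_of_le' hn
      rw [key, if_pos hkl]
    · refine Or.inl (Filter.eventually_atTop.2 ⟨k + l, fun n hn => ?_⟩)
      obtain ⟨m, rfl⟩ := Nat.exists_eq_add_of_le' hn
      rw [key, if_neg hkl]
  -- Moving `w` past `aⁿ b` gives `bⁿ a w`, so `q` is stripped with the roles of `a` and `b`
  -- exchanged.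
  · rw [Set.pair_comm] at hq
    obtain ⟨l, hl⟩ := star_word_mul_pow_mul hb hab hq
    have hpow (n : ℕ) : w * (a ^ n * b) = b ^ n * a * w := by
      have : w * a ^ n = b ^ n * w := SemiconjBy.pow_right (show SemiconjBy w a b from hwa) n
      rw [← mul_assoc, this, mul_assoc, hwb, mul_assoc]
    have e (n : ℕ) : star (a ^ n * b) * (p * star q * w) * (a ^ n * b) =
        star (star p * (a ^ n * b)) * (star q * (b ^ n * a)) * w := by
      rw [mul_assoc _ _ (a ^ n * b), mul_assoc _ w, hpow]
      simp [mul_assoc]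
    simp only [e]
    -- The extra `1` keeps a leading `a` on one side and a leading `b` on the other, so `a⋆ b = 0`
    -- kills the product.
    refine Or.inl (Filter.eventually_atTop.2 ⟨k + l + 1, fun n hn => ?_⟩)
    obtain ⟨m, rfl⟩ := Nat.exists_eq_add_of_le' hn
    have h1 : star p * (a ^ (m + (k + l + 1)) * b) = 0 ∨
        star p * (a ^ (m + (k + l + 1)) * b) = a ^ (m + l + 1) * b := by
      rw [show m + (k + l + 1) = m + l + 1 + k by ring]
      exact hk.imp (fun h => h _) fun h => h _
    have h2 : star q * (b ^ (m + (k + l + 1)) * a) = 0 ∨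
        star q * (b ^ (m + (k + l + 1)) * a) = b ^ (m + k + 1) * a := by
      rw [show m + (k + l + 1) = m + k + 1 + l by ring]
      exact hl.imp (fun h => h _) fun h => h _
    have h3 : star (a ^ (m + l + 1) * b) * (b ^ (m + k + 1) * a) = 0 := by
      rw [pow_succ' b, pow_succ' a]
      simp only [star_mul, mul_assoc]
      rw [← mul_assoc (star a) b, hab]
      simp
    rcases h1 with h1 | h1 <;> rcases h2 with h2 | h2 <;> simp [h1, h2, h3, -star_mul]

end StarRing

/-! ### The relative commutant by approximation -/

section CStarAlgebra

variable {A : Type*} [CStarAlgebra A] {a b w z : A}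

theorem exists_eventually_compression_eq_algebraMap (ha : star a * a = 1) (hb : star b * b = 1)
    (hab : star a * b = 0) (hw : star w = w) (hw2 : w * w = 1)
    (hwa : w * a = b * w) (hwb : w * b = a * w) {x : A}
    (hx : x ∈ StarAlgebra.adjoin ℂ ({a, b, w} : Set A)) :
    ∃ c : ℂ, ∀ᶠ n in Filter.atTop,
      star (a ^ n * b) * x * (a ^ n * b) = algebraMap ℂ A c := by
  have hx' : x ∈ Submodule.span ℂ
      (Submonoid.closure ({a, b, w} ∪ star {a, b, w} : Set A) : Set A) := by
    rw [← StarAlgebra.adjoin_eq_span]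
    exact hx
  clear hx
  induction hx' using Submodule.span_induction with
  | mem x hx =>
    rcases (isWordMonomial_of_mem_closure ha hb hab hw hw2 hwa hwb hx).eventually_compression
      ha hb hab hwa hwb with h | h
    · exact ⟨0, by simpa using h⟩
    · exact ⟨1, by simpa using h⟩
  | zero => exact ⟨0, by simp⟩
  | add x y _ _ hx hy =>
    obtain ⟨c, hc⟩ := hx
    obtain ⟨d, hd⟩ := hy
    refine ⟨c + d, ?_⟩
    filter_upwards [hc, hd] with n h1 h2
    rw [mul_add, add_mul, h1, h2, map_add]
  | smul r x _ hx =>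
    obtain ⟨c, hc⟩ := hx
    refine ⟨r * c, ?_⟩
    filter_upwards [hc] with n h1
    rw [mul_smul_comm, smul_mul_assoc, h1, map_mul, Algebra.smul_def]

/-- The relative commutant of `a`, `b` in the C⋆-algebra generated by `a`, `b` and a self-adjoint
unitary exchanging them is trivial. -/
theorem exists_eq_algebraMap_of_commute_of_mem_closure (ha : star a * a = 1)
    (hb : star b * b = 1) (hab : star a * b = 0) (hw : star w = w) (hw2 : w * w = 1)
    (hwa : w * a = b * w) (hwb : w * b = a * w)
    (hz : z ∈ (StarAlgebra.adjoin ℂ ({a, b, w} : Set A)).topologicalClosure)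
    (hza : Commute z a) (hzb : Commute z b) :
    ∃ c : ℂ, z = algebraMap ℂ A c := by
  have hclosed : IsClosed (Set.range (algebraMap ℂ A)) := by
    have := (Submodule.span ℂ {(1 : A)}).closed_of_finiteDimensional
    convert this using 1
    ext y
    simp [Submodule.mem_span_singleton, Algebra.algebraMap_eq_smul_one]
  suffices z ∈ closure (Set.range (algebraMap ℂ A)) by
    rw [hclosed.closure_eq] at this
    exact this.imp fun _ h => h.symm
  refine Metric.mem_closure_iff.2 fun ε hε => ?_
  obtain ⟨x, hx, hzx⟩ := Metric.mem_closure_iff.1 hz ε hε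
  obtain ⟨c, hc⟩ := exists_eventually_compression_eq_algebraMap ha hb hab hw hw2 hwa hwb hx
  obtain ⟨n, hn⟩ := hc.exists
  refine ⟨_, ⟨c, rfl⟩, lt_of_le_of_lt ?_ hzx⟩
  -- `t` is an isometry commuting with `z`, so compression by `t` fixes `z`, sends `x` to `c` and
  -- does not increase the distance.
  set t := a ^ n * b with ht
  have htt : star t * t = 1 := by
    rw [ht, star_pow_mul_mul_pow_mul ha hb hab, if_pos rfl]
  have hzt : star t * z * t = z := by
    have : Commute z t := (hza.pow_right n).mul_right hzb
    rw [mul_assoc, this.eq, ← mul_assoc, htt, one_mul]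
  have hnorm : ‖t‖ ≤ 1 := by
    have h := CStarRing.norm_star_mul_self (x := t)
    rw [htt] at h
    have h1 : ‖(1 : A)‖ ≤ 1 := by
      rcases subsingleton_or_nontrivial A with _ | _
      · simp [Subsingleton.elim (1 : A) 0]
      · exact CStarRing.norm_one.le
    nlinarith [norm_nonneg t]
  rw [← hn, dist_eq_norm, dist_eq_norm]
  calc ‖z - star t * x * t‖ = ‖star t * (z - x) * t‖ := by rw [mul_sub, sub_mul, hzt]
    _ ≤ ‖star t‖ * ‖z - x‖ * ‖t‖ := norm_mul₃_le
    _ ≤ 1 * ‖z - x‖ * 1 := by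
      rw [norm_star]
      gcongr
    _ = ‖z - x‖ := by ring

end CStarAlgebra

/-! ### Schur's lemma and order-two intertwiners -/

section Operators

variable {H : Type*} [NormedAddCommGroup H] [InnerProductSpace ℂ H] [CompleteSpace H]

/-- Schur's lemma: a normal operator commuting with an irreducible operator algebra is scalar. -/
theorem ActsIrreducibly.exists_eq_algebraMap {B : StarSubalgebra ℂ (H →L[ℂ] H)}
    (hB : ActsIrreducibly B) {z : H →L[ℂ] H} (hz : IsStarNormal z)
    (hcomm : ∀ x ∈ B, Commute z x) : ∃ c : ℂ, z = algebraMap ℂ (H →L[ℂ] H) c := by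
  have := hB.1
  obtain ⟨c, hc⟩ := spectrum.nonempty z
  refine ⟨c, CFC.eq_algebraMap_of_spectrum_subset_singleton z c fun d hd => ?_⟩
  by_contra hdc
  set r : ℝ := dist d c / 2 with hr
  have hrpos : 0 < r := half_pos (dist_pos.2 hdc)
  -- Bumps at two distinct spectral points, with radius half their distance, have product zero. The
  -- kernel of `cfc (f c) z` is then a proper invariant subspace containing the nonzero range of
  -- `cfc (f d) z`.
  let f (e x : ℂ) : ℂ := ((max 0 (r - dist x e) : ℝ) : ℂ)
  have hf (e : ℂ) : Continuous (f e) := by fun_prop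
  have hne (e : ℂ) (he : e ∈ spectrum ℂ z) : cfc (f e) z ≠ 0 := fun h => by
    have h1 : f e e ∈ spectrum ℂ (cfc (f e) z) := by
      rw [cfc_map_spectrum (f e) z hz (hf e).continuousOn]
      exact ⟨e, he, rfl⟩
    rw [h, spectrum.zero_eq, Set.mem_singleton_iff] at h1
    have h2 : max 0 (r - dist e e) = 0 := Complex.ofReal_eq_zero.1 h1
    rw [dist_self, sub_zero, max_eq_right hrpos.le] at h2
    exact hrpos.ne' h2
  have hmul : cfc (f c) z * cfc (f d) z = 0 := by
    rw [← cfc_mul (f c) (f d) z (hf c).continuousOn (hf d).continuousOn]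
    refine (cfc_congr fun x _ => ?_).trans (cfc_zero ℂ z)
    have htri := dist_triangle_left d c x
    rcases le_total r (dist x c) with h | h
    · simp [f, max_eq_left (sub_nonpos.2 h)]
    · have h' : r ≤ dist x d := by linarith
      simp [f, max_eq_left (sub_nonpos.2 h')]
  rcases hB.2 (LinearMap.ker (cfc (f c) z).toLinearMap) (cfc (f c) z).isClosed_ker
    (fun x hx v hv => by
      -- Commutation of `x` with `z⋆` is also needed; it holds because `B` contains `x⋆`.
      have h1 : Commute (cfc (f c) z) x := (hcomm x hx).cfc (by
        simpa using (hcomm _ (star_mem hx)).star_star) _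
      have h2 := congrArg (fun T : H →L[ℂ] H => T v) h1.eq
      have h3 : cfc (f c) z v = 0 := hv
      simpa [h3] using h2) with h | h
  · refine hne d hd (ContinuousLinearMap.ext fun v => ?_)
    have : cfc (f d) z v ∈ LinearMap.ker (cfc (f c) z).toLinearMap :=
      congrArg (fun T : H →L[ℂ] H => T v) hmul
    rw [h] at this
    simpa using this
  · refine hne c hc (ContinuousLinearMap.ext fun v => ?_)
    have : v ∈ LinearMap.ker (cfc (f c) z).toLinearMap := h ▸ Submodule.mem_top
    exact this

variable {S₁ S₂ u w : H →L[ℂ] H}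

theorem IsCuntzPair.star_mul_left (h : IsCuntzPair S₁ S₂) : star S₁ * S₁ = 1 :=
  (ContinuousLinearMap.isometry_iff_adjoint_comp_self S₁).1 h.isometry_left

theorem IsCuntzPair.star_mul_right (h : IsCuntzPair S₁ S₂) : star S₂ * S₂ = 1 :=
  (ContinuousLinearMap.isometry_iff_adjoint_comp_self S₂).1 h.isometry_right

/-- Sandwiching the Cuntz relation between `S₁⋆` and `S₂` gives `X + X = X` for `X = S₁⋆ S₂`. -/
theorem IsCuntzPair.star_mul_eq_zero (h : IsCuntzPair S₁ S₂) : star S₁ * S₂ = 0 := by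
  have h1 := congrArg (fun T => star S₁ * T * S₂) h.cuntz_relation
  simp only [mul_add, add_mul, mul_one] at h1
  have e1 : star S₁ * (S₁ * star S₁) * S₂ = star S₁ * S₂ := by
    rw [← mul_assoc, h.star_mul_left, one_mul]
  have e2 : star S₁ * (S₂ * star S₂) * S₂ = star S₁ * S₂ := by
    rw [mul_assoc, mul_assoc S₂, h.star_mul_right, mul_one]
  rw [e1, e2] at h1
  simpa using h1

namespace IsOrderTwoIntertwiner

theorem mul_self (hu : IsOrderTwoIntertwiner S₁ S₂ u) : u * u = 1 := by
  rw [← sq, hu.sq_eq_one]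

theorem star_eq (hu : IsOrderTwoIntertwiner S₁ S₂ u) : star u = u := by
  calc star u = star u * u * u := by rw [mul_assoc, hu.mul_self, mul_one]
    _ = u := by rw [(Unitary.mem_iff.1 hu.mem_unitary).1, one_mul]

theorem intertwines_symm (hu : IsOrderTwoIntertwiner S₁ S₂ u) : u * S₂ = S₁ * u := by
  calc u * S₂ = u * (S₂ * u) * u := by rw [mul_assoc, mul_assoc S₂, hu.mul_self, mul_one]
    _ = S₁ * u := by rw [← hu.intertwines, ← mul_assoc, hu.mul_self, one_mul]

theorem neg (hu : IsOrderTwoIntertwiner S₁ S₂ u) : IsOrderTwoIntertwiner S₁ S₂ (-u) where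
  mem_unitary := by
    have := Unitary.mem_iff.1 hu.mem_unitary
    exact Unitary.mem_iff.2 (by simpa using this)
  sq_eq_one := by rw [neg_sq, hu.sq_eq_one]
  intertwines := by rw [neg_mul, mul_neg, hu.intertwines]

theorem ne_neg [Nontrivial H] (hu : IsOrderTwoIntertwiner S₁ S₂ u) : u ≠ -u := fun h => by
  have h0 : u = 0 := by
    have h2 : (2 : ℂ) • u = 0 := by rw [two_smul, add_eq_zero_iff_eq_neg, ← h]
    exact (smul_eq_zero.1 h2).resolve_left two_ne_zero
  have h1 := hu.mul_self
  rw [h0, mul_zero] at h1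
  exact zero_ne_one h1

theorem commute_mul_left (hu : IsOrderTwoIntertwiner S₁ S₂ u)
    (hw : IsOrderTwoIntertwiner S₁ S₂ w) : Commute (u * w) S₁ := by
  rw [Commute, SemiconjBy, mul_assoc, hw.intertwines, ← mul_assoc, hu.intertwines_symm, mul_assoc]

theorem commute_mul_right (hu : IsOrderTwoIntertwiner S₁ S₂ u)
    (hw : IsOrderTwoIntertwiner S₁ S₂ w) : Commute (u * w) S₂ := by
  rw [Commute, SemiconjBy, mul_assoc, hw.intertwines_symm, ← mul_assoc, hu.intertwines, mul_assoc]

theorem eq_or_eq_neg_of_mul_eq_algebraMap (hu : IsOrderTwoIntertwiner S₁ S₂ u)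
    (hw : IsOrderTwoIntertwiner S₁ S₂ w) {c : ℂ} (h : u * w = algebraMap ℂ (H →L[ℂ] H) c) :
    u = w ∨ u = -w := by
  rcases subsingleton_or_nontrivial H with _ | _
  · exact Or.inl (Subsingleton.elim _ _)
  have huw : u = c • w := by
    rw [Algebra.smul_def, ← h, mul_assoc, hw.mul_self, mul_one]
  have hc : c * c = 1 := by
    have h1 := hu.mul_self
    rw [huw, smul_mul_smul_comm, hw.mul_self, ← Algebra.algebraMap_eq_smul_one] at h1
    exact (algebraMap ℂ (H →L[ℂ] H)).injective (h1.trans (map_one _).symm)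
  rcases mul_self_eq_one_iff.1 hc with rfl | rfl
  · exact Or.inl (by simpa using huw)
  · exact Or.inr (by simpa using huw)

theorem eq_or_eq_neg_of_cstarGenerated_le (hS : IsCuntzPair S₁ S₂)
    (hu : IsOrderTwoIntertwiner S₁ S₂ u) (hw : IsOrderTwoIntertwiner S₁ S₂ w)
    (h : cstarGenerated {S₁, S₂, u} ≤ cstarGenerated {S₁, S₂, w}) : u = w ∨ u = -w := by
  have mu : u ∈ cstarGenerated {S₁, S₂, w} :=
    h (subset_closure (StarAlgebra.subset_adjoin ℂ _ (by simp)))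
  have mw : w ∈ cstarGenerated {S₁, S₂, w} :=
    subset_closure (StarAlgebra.subset_adjoin ℂ _ (by simp))
  obtain ⟨c, hc⟩ := exists_eq_algebraMap_of_commute_of_mem_closure hS.star_mul_left
    hS.star_mul_right hS.star_mul_eq_zero hw.star_eq hw.mul_self hw.intertwines
    hw.intertwines_symm (mul_mem mu mw) (hu.commute_mul_left hw) (hu.commute_mul_right hw)
  exact hu.eq_or_eq_neg_of_mul_eq_algebraMap hw hc

theorem cstarGenerated_neg_le :
    cstarGenerated {S₁, S₂, -w} ≤ cstarGenerated {S₁, S₂, w} := by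
  refine StarSubalgebra.topologicalClosure_mono (StarAlgebra.adjoin_le ?_)
  have hsub := StarAlgebra.subset_adjoin ℂ ({S₁, S₂, w} : Set (H →L[ℂ] H))
  rintro x (rfl | rfl | rfl)
  · exact hsub (by simp)
  · exact hsub (by simp)
  · exact neg_mem (hsub (by simp))

theorem eq_or_eq_neg_of_actsIrreducibly (hB : ActsIrreducibly (cstarGenerated {S₁, S₂}))
    (hu : IsOrderTwoIntertwiner S₁ S₂ u) (hw : IsOrderTwoIntertwiner S₁ S₂ w) :
    u = w ∨ u = -w := by
  have hstar : star (u * w) = w * u := by rw [star_mul, hu.star_eq, hw.star_eq]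
  have hnormal : IsStarNormal (u * w) := ⟨by
    rw [hstar, Commute, SemiconjBy, mul_assoc, ← mul_assoc u, hu.mul_self, one_mul, hw.mul_self,
      mul_assoc, ← mul_assoc w, hw.mul_self, one_mul, hu.mul_self]⟩
  -- The centralizer is a closed star subalgebra, so checking `S₁` and `S₂` against `u w` and its
  -- adjoint `w u` suffices.
  have hle : cstarGenerated {S₁, S₂} ≤ StarSubalgebra.centralizer ℂ {u * w} := by
    refine StarSubalgebra.topologicalClosure_minimal (StarAlgebra.adjoin_le ?_)
      (Set.isClosed_centralizer _)
    rintro x (rfl | rfl) <;> refine (StarSubalgebra.mem_centralizer_iff ℂ).2 ?_ <;>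
      rintro _ rfl <;> rw [hstar]
    · exact ⟨hu.commute_mul_left hw, hw.commute_mul_left hu⟩
    · exact ⟨hu.commute_mul_right hw, hw.commute_mul_right hu⟩
  obtain ⟨c, hc⟩ := hB.exists_eq_algebraMap hnormal fun x hx =>
    ((StarSubalgebra.mem_centralizer_iff ℂ).1 (hle hx) _ rfl).1
  exact hu.eq_or_eq_neg_of_mul_eq_algebraMap hw hc

end IsOrderTwoIntertwiner

end Operators

theorem mainTheorem4 {H : Type*} [NormedAddCommGroup H] [InnerProductSpace ℂ H]
    [CompleteSpace H] (S₁ S₂ : H →L[ℂ] H) (hS : IsCuntzPair S₁ S₂) :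
    (∀ u w : H →L[ℂ] H, IsOrderTwoIntertwiner S₁ S₂ u → IsOrderTwoIntertwiner S₁ S₂ w →
      cstarGenerated {S₁, S₂, u} ≤ cstarGenerated {S₁, S₂, w} → u = w ∨ u = -w) ∧
    (Nontrivial H → ∀ w : H →L[ℂ] H, IsOrderTwoIntertwiner S₁ S₂ w →
      w ≠ -w ∧ {u | IsOrderTwoIntertwiner S₁ S₂ u ∧
        cstarGenerated {S₁, S₂, u} ≤ cstarGenerated {S₁, S₂, w}} = {w, -w}) ∧
    (ActsIrreducibly (cstarGenerated {S₁, S₂}) →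
      {u | IsOrderTwoIntertwiner S₁ S₂ u} = ∅ ∨
        ∃ w, w ≠ -w ∧ {u | IsOrderTwoIntertwiner S₁ S₂ u} = {w, -w}) := by
  refine ⟨fun u w hu hw h => hu.eq_or_eq_neg_of_cstarGenerated_le hS hw h, fun _ w hw => ?_,
    fun hB => ?_⟩
  · refine ⟨hw.ne_neg, Set.ext fun u => ⟨fun h => ?_, ?_⟩⟩
    · exact h.1.eq_or_eq_neg_of_cstarGenerated_le hS hw h.2
    · rintro (rfl | rfl)
      · exact ⟨hw, le_rfl⟩
      · exact ⟨hw.neg, IsOrderTwoIntertwiner.cstarGenerated_neg_le⟩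
  · have := hB.1
    refine (Set.eq_empty_or_nonempty _).imp id ?_
    rintro ⟨w, hw⟩
    refine ⟨w, IsOrderTwoIntertwiner.ne_neg hw, Set.ext fun u => ⟨fun hu => ?_, ?_⟩⟩
    · exact IsOrderTwoIntertwiner.eq_or_eq_neg_of_actsIrreducibly hB hu hw
    · rintro (rfl | rfl)
      · exact hw
      · exact IsOrderTwoIntertwiner.neg hw
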